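/- Let $d\ge 1$ be an integer, $\alpha>-1$ real, and let $B^d$ be the open Euclidean unit ball of $\mathbb{R}^d$. For scalar-, vector- or tensor-valued functions put $\langle u,v\rangle_\alpha=\int_{B^d}u(x)\cdot\overline{v(x)}\,(1-\|x\|^2)^\alpha\,dx$ (sum over all entries; real or complex scalars), let $c_\alpha=\langle 1,1\rangle_\alpha$, and $$\langle u,v\rangle_{\alpha,1}=\langle\nabla u,\nabla v\rangle_\alpha+c_\alpha^{-1}\langle u,1\rangle_\alpha\,\overline{\langle v,1\rangle_\alpha}.$$ Let $\Pi^d_n$ be the space of $d$-variate polynomials of total degree at most $n$ ($\Pi^d_n=\{0\}$ for $n<0$) and $$\mathcal V^{\alpha,1}_n=\{p\in\Pi^d_n:\ \langle p,q\rangle_{\alpha,1}=0\ \text{ for all } q\in\Pi^d_{n-1}\}.$$ Let $D_{i,j}=x_i\partial_j-x_j\partial_i$ (acting entrywise on vector fields) and $$B^\alpha(u,v)=\langle\nabla u,\nabla v\rangle_{\alpha+1}+\sum_{1\le i<j\le d}\langle D_{i,j}u,D_{i,j}v\rangle_\alpha,\qquad B^{\alpha,1}(u,v)=\sum_{k=1}^d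 B^\alpha(\partial_k u,\partial_k v).$$ **Theorem.** Let $n\ge 0$ be an integer and $p_n\in\mathcal V^{\alpha,1}_n$. Then, for all $q\in C^2(\overline{B^d})$, $$B^{\alpha,1}(p_n,q)=\langle\nabla\nabla p_n,\nabla\nabla q\rangle_{\alpha+1}+\sum_{1\le i<j\le d}\langle D_{i,j}\nabla p_n,D_{i,j}\nabla q\rangle_\alpha=\lambda^{(\alpha,1)}_n\,\langle p_n,q\rangle_{\alpha,1},$$ where $\lambda^{(\alpha,1)}_n=0$ if $n\le 1$ and $\lambda^{(\alpha,1)}_n=(n-1)(n-1+d+2\alpha)$ if $n\ge 2$. -/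

import Mathlib

open MeasureTheory
open scoped ComplexConjugate

namespace SobolevBall

noncomputable section

/-- `d`-dimensional Euclidean space. -/
abbrev Eu (d : ℕ) : Type := EuclideanSpace ℝ (Fin d)

/-- The weight `W_α(x) = (1 - ‖x‖²)^α`; it is only ever used on the open unit ball. -/
def weight {d : ℕ} (α : ℝ) (x : Eu d) : ℝ := (1 - ‖x‖ ^ 2) ^ α

/-- The weighted inner product `⟨u, v⟩_α` of scalar functions on the open unit ball. -/
def ip {𝕜 : Type*} [RCLike 𝕜] {d : ℕ} (α : ℝ) (u v : Eu d → 𝕜) : 𝕜 :=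
  ∫ x in Metric.ball (0 : Eu d) 1, u x * conj (v x) * ((weight α x : ℝ) : 𝕜)

/-- The weighted inner product `⟨F, G⟩_α` of vector or tensor valued functions
(entries indexed by a finite type). -/
def ipT {𝕜 : Type*} [RCLike 𝕜] {d : ℕ} {ι : Type*} [Fintype ι] (α : ℝ)
    (F G : Eu d → ι → 𝕜) : 𝕜 :=
  ∫ x in Metric.ball (0 : Eu d) 1, (∑ i, F x i * conj (G x i)) * ((weight α x : ℝ) : 𝕜)

/-- The partial derivative `∂_k u`. -/
def pd {𝕜 : Type*} [RCLike 𝕜] {d : ℕ} (k : Fin d) (u : Eu d → 𝕜) : Eu d → 𝕜 :=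
  fun x => fderiv ℝ u x (EuclideanSpace.single k (1 : ℝ))

/-- The gradient `∇u`. -/
def grad {𝕜 : Type*} [RCLike 𝕜] {d : ℕ} (u : Eu d → 𝕜) : Eu d → Fin d → 𝕜 :=
  fun x k => pd k u x

/-- The second gradient `∇∇u`. -/
def hess {𝕜 : Type*} [RCLike 𝕜] {d : ℕ} (u : Eu d → 𝕜) : Eu d → Fin d × Fin d → 𝕜 :=
  fun x kl => pd kl.1 (pd kl.2 u) x

/-- The angular operator `D_{i,j} = x_i ∂_j - x_j ∂_i`. -/
def angular {𝕜 : Type*} [RCLike 𝕜] {d : ℕ} (i j : Fin d) (u : Eu d → 𝕜) : Eu d → 𝕜 :=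
  fun x => ((x i : ℝ) : 𝕜) * pd j u x - ((x j : ℝ) : 𝕜) * pd i u x

/-- Entrywise application of the angular operator to the gradient, `D_{i,j} ∇u`. -/
def angularGrad {𝕜 : Type*} [RCLike 𝕜] {d : ℕ} (i j : Fin d) (u : Eu d → 𝕜) :
    Eu d → Fin d → 𝕜 :=
  fun x k => angular i j (pd k u) x

/-- The Sobolev inner product
`⟨u, v⟩_{α,1} = ⟨∇u, ∇v⟩_α + c_α⁻¹ ⟨u, 1⟩_α conj ⟨v, 1⟩_α`, with `c_α = ⟨1, 1⟩_α`. -/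
def ipSob {𝕜 : Type*} [RCLike 𝕜] {d : ℕ} (α : ℝ) (u v : Eu d → 𝕜) : 𝕜 :=
  ipT α (grad u) (grad v) +
    (ip α (fun _ : Eu d => (1 : 𝕜)) (fun _ => 1))⁻¹ *
      (ip α u (fun _ => 1) * conj (ip α v (fun _ => 1)))

/-- `B^α(u, v) = ⟨∇u, ∇v⟩_{α+1} + ∑_{i<j} ⟨D_{i,j} u, D_{i,j} v⟩_α`. -/
def formB {𝕜 : Type*} [RCLike 𝕜] {d : ℕ} (α : ℝ) (u v : Eu d → 𝕜) : 𝕜 :=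
  ipT (α + 1) (grad u) (grad v) +
    ∑ i : Fin d, ∑ j ∈ Finset.Ioi i, ip α (angular i j u) (angular i j v)

/-- `B^{α,1}(u, v) = ∑_k B^α(∂_k u, ∂_k v)`. -/
def formB1 {𝕜 : Type*} [RCLike 𝕜] {d : ℕ} (α : ℝ) (u v : Eu d → 𝕜) : 𝕜 :=
  ∑ k : Fin d, formB α (pd k u) (pd k v)

/-- `Π^d_n`, the polynomials of total degree at most `n`; it is `{0}` for `n < 0`. -/
def polySpace (𝕜 : Type*) [RCLike 𝕜] (d : ℕ) (n : ℤ) :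
    Submodule 𝕜 (MvPolynomial (Fin d) 𝕜) :=
  if 0 ≤ n then MvPolynomial.restrictTotalDegree (Fin d) 𝕜 n.toNat else ⊥

/-- The function on `ℝ^d` given by a polynomial. -/
def polyFun {𝕜 : Type*} [RCLike 𝕜] {d : ℕ} (P : MvPolynomial (Fin d) 𝕜) : Eu d → 𝕜 :=
  fun x => MvPolynomial.eval (fun i => ((x i : ℝ) : 𝕜)) P

/-- `V^{α,1}_n`, the polynomials in `Π^d_n` that are `(α,1)`-orthogonal to `Π^d_{n-1}`. -/
def sobOrthPoly (𝕜 : Type*) [RCLike 𝕜] (d : ℕ) (α : ℝ) (n : ℕ) :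
    Set (MvPolynomial (Fin d) 𝕜) :=
  {P | P ∈ polySpace 𝕜 d n ∧
    ∀ Q ∈ polySpace 𝕜 d ((n : ℤ) - 1), ipSob α (polyFun P) (polyFun Q) = 0}

/-- `λ^{(α)}_n = n (n + d + 2 α)`. -/
def eig (d : ℕ) (α : ℝ) (n : ℕ) : ℝ := n * (n + d + 2 * α)

/-- `λ^{(α,1)}_n`, equal to `0` for `n ≤ 1` and to `λ^{(α)}_{n-1}` for `n ≥ 2`. -/
def eigSob (d : ℕ) (α : ℝ) (n : ℕ) : ℝ := if n ≤ 1 then 0 else eig d α (n - 1)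

end

end SobolevBall

/-!
The eigenvalue relation rests on a factorization. Write `E = ∑ xᵢ ∂ᵢ` for the Euler operator.
Integration by parts shows that `B^α` is represented with respect to `⟨·, ·⟩_α` by
`L = -Δ + E² + (d + 2α) E` (`formB_polyFun`). Since `∂_k E = (E + 1) ∂_k`, the operator
`M = -Δ + (E - 1) (E - 1 + d + 2α)` satisfies `∂_k M = L ∂_k` (`pderiv_sobOp`), and therefore
`B^{α,1}(P, q) = ⟨∇MP, ∇q⟩_α` for every polynomial `P` (`formB1_polyFun`).

Applied to a polynomial of degree at most `n`, `M` preserves the degree bound and multiplies the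
part of degree `n` by `λ = (n - 1) (n - 1 + d + 2α)` (`sobOp_sub_mem_polySpace`). If `P` is Sobolev
orthogonal of degree `n ≥ 1`, it has mean zero, and the remainder `R = MP - λP` has degree less
than `n`. Symmetry of `B^{α,1}` gives `⟨∇MP, ∇R⟩_α = ⟨∇P, ∇MR⟩_α = 0`, and `⟨∇P, ∇R⟩_α = 0`, so
that `⟨∇R, ∇R⟩_α = 0` and `∇MP = λ∇P` on the ball (`grad_sobOp_ae_eq`).

The analytic input is the integration by parts, with a weight that may be unbounded at the
boundary. By Lagrange's identity the angular terms and the term with weight `W_{α+1}` combine into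
the integral of `∇u · ∇v - (x · ∇u) (x · ∇v)` against `W_α` (`formB_eq_wint`), so the relevant field
is `W_α (∇u - x (x · ∇u)) v`. Its normal component `x · (∇u - x (x · ∇u)) = (1 - ‖x‖²) (x · ∇u)`
vanishes at the boundary, and a radial cutoff with dominated convergence yields the divergence
theorem without boundary term (`wint_divergence`).
-/

namespace SobolevBall

open Filter Topology Metric

variable {𝕜 : Type*} [RCLike 𝕜] {d : ℕ}

/-! ### The weight and weighted integrals of bounded continuous functions -/

theorem one_sub_norm_sq_pos {x : Eu d} (hx : x ∈ ball (0 : Eu d) 1) : 0 < 1 - ‖x‖ ^ 2 := by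
  have h : ‖x‖ < 1 := by simpa using hx
  nlinarith [norm_nonneg x]

theorem weight_pos (α : ℝ) {x : Eu d} (hx : x ∈ ball (0 : Eu d) 1) : 0 < weight α x :=
  Real.rpow_pos_of_pos (one_sub_norm_sq_pos hx) α

theorem weight_add_one (α : ℝ) {x : Eu d} (hx : x ∈ ball (0 : Eu d) 1) :
    weight (α + 1) x = weight α x * (1 - ‖x‖ ^ 2) :=
  Real.rpow_add_one (one_sub_norm_sq_pos hx).ne' α

theorem integrableOn_weight (hd : 1 ≤ d) {α : ℝ} (hα : -1 < α) :
    IntegrableOn (weight (d := d) α) (ball 0 1) := by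
  have : Nonempty (Fin d) := ⟨⟨0, hd⟩⟩
  have : Nontrivial (Eu d) := inferInstance
  refine (integrableOn_fun_norm_addHaar (E := Eu d) volume
    (f := fun r : ℝ => (1 - r ^ 2) ^ α) (r := 1)).2 ?_
  -- near `1` the radial weight factors as the integrable `(1 - r)^α` times a continuous function
  have h1 : IntegrableOn (fun r : ℝ => (1 - r) ^ α) (Set.Icc 0 1) := by
    have h := (intervalIntegral.intervalIntegrable_rpow' (a := 0) (b := 1) hα).comp_sub_left 1
    simp only [sub_zero, sub_self] at h
    rw [integrableOn_Icc_iff_integrableOn_Ioc]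
    exact (intervalIntegrable_iff_integrableOn_Ioc_of_le zero_le_one).1 h.symm
  have h2 : ContinuousOn (fun r : ℝ => r ^ (Module.finrank ℝ (Eu d) - 1) * (1 + r) ^ α)
      (Set.Icc 0 1) := by
    refine ContinuousOn.mul (by fun_prop) (ContinuousOn.rpow_const (by fun_prop) ?_)
    intro r hr
    exact Or.inl (by linarith [hr.1])
  have h3 := (h1.continuousOn_mul h2 isCompact_Icc).mono_set Set.Ioo_subset_Icc_self
  refine h3.congr_fun (fun r hr => ?_) measurableSet_Ioo
  have : (1 - r ^ 2 : ℝ) = (1 + r) * (1 - r) := by ring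
  simp only [smul_eq_mul]
  rw [this, Real.mul_rpow (by linarith [hr.1]) (by linarith [hr.2]), mul_assoc]

/-- Functions that are continuous and bounded on the open unit ball. -/
def BddContOnBall (f : Eu d → 𝕜) : Prop :=
  ContinuousOn f (ball 0 1) ∧ ∃ C : ℝ, ∀ x ∈ ball (0 : Eu d) 1, ‖f x‖ ≤ C

/-- The integral of `f` over the unit ball with respect to the weight `W_α`. -/
noncomputable def wint (α : ℝ) (f : Eu d → 𝕜) : 𝕜 :=
  ∫ x in ball (0 : Eu d) 1, f x * ((weight α x : ℝ) : 𝕜)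

namespace BddContOnBall

variable {f g : Eu d → 𝕜}

theorem of_continuousOn_closedBall (hf : ContinuousOn f (closedBall 0 1)) : BddContOnBall f := by
  obtain ⟨C, hC⟩ := (isCompact_closedBall (0 : Eu d) 1).exists_bound_of_continuousOn hf
  exact ⟨hf.mono ball_subset_closedBall, C, fun x hx => hC x (ball_subset_closedBall hx)⟩

theorem of_continuous (hf : Continuous f) : BddContOnBall f :=
  of_continuousOn_closedBall hf.continuousOn

theorem congr (hf : BddContOnBall f) (h : ∀ x ∈ ball (0 : Eu d) 1, g x = f x) :
    BddContOnBall g := by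
  obtain ⟨hc, C, hC⟩ := hf
  exact ⟨hc.congr h, C, fun x hx => by rw [h x hx]; exact hC x hx⟩

theorem add (hf : BddContOnBall f) (hg : BddContOnBall g) :
    BddContOnBall (fun x => f x + g x) := by
  obtain ⟨hc, C, hC⟩ := hf
  obtain ⟨hc', C', hC'⟩ := hg
  exact ⟨hc.add hc', C + C', fun x hx => norm_add_le_of_le (hC x hx) (hC' x hx)⟩

theorem mul (hf : BddContOnBall f) (hg : BddContOnBall g) :
    BddContOnBall (fun x => f x * g x) := by
  obtain ⟨hc, C, hC⟩ := hf
  obtain ⟨hc', C', hC'⟩ := hg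
  exact ⟨hc.mul hc', C * C', fun x hx => norm_mul_le_of_le (hC x hx) (hC' x hx)⟩

theorem const (c : 𝕜) : BddContOnBall (fun _ : Eu d => c) := of_continuous continuous_const

theorem coord (i : Fin d) : BddContOnBall (fun x : Eu d => ((x i : ℝ) : 𝕜)) :=
  of_continuous (RCLike.continuous_ofReal.comp (by fun_prop))

theorem neg (hf : BddContOnBall f) : BddContOnBall (fun x => -f x) := by
  simpa using (const (-1 : 𝕜)).mul hf

theorem sub (hf : BddContOnBall f) (hg : BddContOnBall g) :
    BddContOnBall (fun x => f x - g x) := by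
  simpa [sub_eq_add_neg] using hf.add hg.neg

theorem star (hf : BddContOnBall f) : BddContOnBall (fun x => conj (f x)) := by
  obtain ⟨hc, C, hC⟩ := hf
  exact ⟨RCLike.continuous_conj.comp_continuousOn hc, C, fun x hx => by simpa using hC x hx⟩

theorem sum {ι : Type*} (s : Finset ι) {F : ι → Eu d → 𝕜} (h : ∀ i ∈ s, BddContOnBall (F i)) :
    BddContOnBall (fun x => ∑ i ∈ s, F i x) := by
  classical
  induction s using Finset.induction_on with
  | empty => simpa using const (0 : 𝕜)
  | insert a s ha ih =>
    simp only [Finset.sum_insert ha]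
    exact (h a (by simp)).add (ih fun i hi => h i (by simp [hi]))

theorem integrableOn (hd : 1 ≤ d) {α : ℝ} (hα : -1 < α) (hf : BddContOnBall f) :
    IntegrableOn (fun x => f x * ((weight α x : ℝ) : 𝕜)) (ball 0 1) := by
  obtain ⟨hc, C, hC⟩ := hf
  refine Integrable.bdd_mul (integrableOn_weight hd hα).ofReal
    (hc.aestronglyMeasurable measurableSet_ball) (c := C) ?_
  exact ae_restrict_of_forall_mem measurableSet_ball hC

end BddContOnBall

section wint

variable {f g : Eu d → 𝕜} {α : ℝ}

theorem wint_congr (h : ∀ x ∈ ball (0 : Eu d) 1, f x = g x) : wint α f = wint α g :=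
  setIntegral_congr_fun measurableSet_ball fun x hx => by simp only [h x hx]

theorem wint_add (hd : 1 ≤ d) (hα : -1 < α) (hf : BddContOnBall f) (hg : BddContOnBall g) :
    wint α (fun x => f x + g x) = wint α f + wint α g := by
  simp only [wint, add_mul]
  exact integral_add (hf.integrableOn hd hα) (hg.integrableOn hd hα)

theorem wint_const_mul (c : 𝕜) : wint α (fun x => c * f x) = c * wint α f := by
  simp only [wint, mul_assoc]
  exact integral_const_mul _ _

theorem wint_sub (hd : 1 ≤ d) (hα : -1 < α) (hf : BddContOnBall f) (hg : BddContOnBall g) :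
    wint α (fun x => f x - g x) = wint α f - wint α g := by
  simp only [wint, sub_mul]
  exact integral_sub (hf.integrableOn hd hα) (hg.integrableOn hd hα)

theorem wint_sum (hd : 1 ≤ d) (hα : -1 < α) {ι : Type*} (s : Finset ι) {F : ι → Eu d → 𝕜}
    (h : ∀ i ∈ s, BddContOnBall (F i)) :
    wint α (fun x => ∑ i ∈ s, F i x) = ∑ i ∈ s, wint α (F i) := by
  simp only [wint, Finset.sum_mul]
  exact integral_finsetSum s fun i hi => (h i hi).integrableOn hd hα

theorem wint_conj : wint α (fun x => conj (f x)) = conj (wint α f) := by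
  simp only [wint]
  rw [← integral_conj]
  simp

theorem wint_add_one : wint (α + 1) f = wint α (fun x => ((1 - ‖x‖ ^ 2 : ℝ) : 𝕜) * f x) := by
  refine setIntegral_congr_fun measurableSet_ball fun x hx => ?_
  simp only [weight_add_one α hx, RCLike.ofReal_mul]
  ring

theorem wint_one_ne_zero (hd : 1 ≤ d) (hα : -1 < α) :
    wint α (fun _ : Eu d => (1 : 𝕜)) ≠ 0 := by
  simp only [wint, one_mul, integral_ofReal, ne_eq, RCLike.ofReal_eq_zero]
  refine ne_of_gt ((setIntegral_pos_iff_support_of_nonneg_ae ?_ (integrableOn_weight hd hα)).2 ?_)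
  · exact ae_restrict_of_forall_mem measurableSet_ball fun x hx => (weight_pos α hx).le
  · have : ball (0 : Eu d) 1 ⊆ Function.support (weight α) ∩ ball 0 1 :=
      fun x hx => ⟨(weight_pos α hx).ne', hx⟩
    exact (measure_ball_pos volume _ one_pos).trans_le (measure_mono this)

/-- If the weighted integral of a sum of squared moduli vanishes, each function vanishes almost
everywhere on the ball. -/
theorem ae_eq_zero_of_wint_sum_eq_zero (hd : 1 ≤ d) (hα : -1 < α) {F : Fin d → Eu d → 𝕜}
    (hF : ∀ i, BddContOnBall (F i)) (h : wint α (fun x => ∑ i, F i x * conj (F i x)) = 0) :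
    ∀ᵐ x ∂volume.restrict (ball (0 : Eu d) 1), ∀ i, F i x = 0 := by
  have hint := (BddContOnBall.sum Finset.univ fun i _ => (hF i).mul (hF i).star).integrableOn hd hα
  have key : ∀ x, (∑ i, F i x * conj (F i x)) * ((weight α x : ℝ) : 𝕜) =
      (((∑ i, ‖F i x‖ ^ 2) * weight α x : ℝ) : 𝕜) := by
    intro x
    simp [RCLike.mul_conj]
  simp only [wint, key, integral_ofReal, RCLike.ofReal_eq_zero] at h
  simp only [key] at hint
  have hint' : IntegrableOn (fun x => (∑ i, ‖F i x‖ ^ 2) * weight α x) (ball 0 1) := by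
    simpa [IntegrableOn] using hint.re
  have h0 := (setIntegral_eq_zero_iff_of_nonneg_ae ?_ hint').1 h
  · filter_upwards [h0, ae_restrict_mem measurableSet_ball] with x hx hxb i
    have h1 : ∑ i, ‖F i x‖ ^ 2 = 0 := by
      simpa [(weight_pos α hxb).ne'] using hx
    have h2 := (Finset.sum_eq_zero_iff_of_nonneg fun i _ => sq_nonneg _).1 h1 i (Finset.mem_univ i)
    simpa using h2
  · exact ae_restrict_of_forall_mem measurableSet_ball fun x hx =>
      mul_nonneg (Finset.sum_nonneg fun i _ => sq_nonneg _) (weight_pos α hx).le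

end wint

/-! ### A weighted divergence theorem -/

/-- The integral of a partial derivative of a compactly supported `C¹` function vanishes. -/
theorem integral_pd_eq_zero {F : Eu d → 𝕜} (hF : ContDiff ℝ 1 F) (hc : HasCompactSupport F)
    (i : Fin d) : Integrable (pd i F) ∧ ∫ x, pd i F x = 0 := by
  have h1 : Continuous (pd i F) := (hF.continuous_fderiv one_ne_zero).clm_apply continuous_const
  have h2 : HasCompactSupport (pd i F) := (hc.fderiv ℝ).comp_left (g := fun L : Eu d →L[ℝ] 𝕜 =>
    L (EuclideanSpace.single i (1 : ℝ))) rfl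
  have h3 := h1.integrable_of_hasCompactSupport (μ := volume) h2
  refine ⟨h3, ?_⟩
  have := integral_mul_fderiv_eq_neg_fderiv_mul_of_integrable (μ := (volume : Measure (Eu d)))
    (f := fun _ : Eu d => (1 : 𝕜)) (g := F) (v := EuclideanSpace.single i (1 : ℝ))
    (by simp) (by simp only [one_mul]; exact h3)
    (by simpa using hF.continuous.integrable_of_hasCompactSupport hc)
    (fun x _ => by fun_prop) (fun x _ => (hF.differentiable one_ne_zero) x)
  simpa [pd] using this

theorem hasFDerivAt_one_sub_norm_sq (x : Eu d) :
    HasFDerivAt (fun y : Eu d => 1 - ‖y‖ ^ 2) (-(2 • innerSL ℝ x) : Eu d →L[ℝ] ℝ) x :=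
  (hasStrictFDerivAt_norm_sq x).hasFDerivAt.const_sub 1

/-- The product rule for a radial factor `θ(1 - ‖x‖²)`. -/
theorem pd_radial_mul {θ : ℝ → ℝ} {h : Eu d → 𝕜} {x : Eu d}
    (hθ : DifferentiableAt ℝ θ (1 - ‖x‖ ^ 2)) (hh : DifferentiableAt ℝ h x) (i : Fin d) :
    pd i (fun y => ((θ (1 - ‖y‖ ^ 2) : ℝ) : 𝕜) * h y) x =
      ((θ (1 - ‖x‖ ^ 2) : ℝ) : 𝕜) * pd i h x -
        2 * ((deriv θ (1 - ‖x‖ ^ 2) : ℝ) : 𝕜) * (((x i : ℝ) : 𝕜) * h x) := by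
  have h1 : HasFDerivAt (fun y : Eu d => θ (1 - ‖y‖ ^ 2))
      (deriv θ (1 - ‖x‖ ^ 2) • (-(2 • innerSL ℝ x) : Eu d →L[ℝ] ℝ)) x :=
    hθ.hasDerivAt.comp_hasFDerivAt x (hasFDerivAt_one_sub_norm_sq x)
  have h2 : HasFDerivAt (fun y => θ (1 - ‖y‖ ^ 2) • h y) _ x := h1.smul hh.hasFDerivAt
  have h3 : (fun y => ((θ (1 - ‖y‖ ^ 2) : ℝ) : 𝕜) * h y) = fun y => θ (1 - ‖y‖ ^ 2) • h y := by
    funext y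
    rw [RCLike.real_smul_eq_coe_mul]
  simp only [pd]
  rw [h3, h2.fderiv]
  simp [RCLike.real_smul_eq_coe_mul, EuclideanSpace.inner_single_right]
  have h4 : algebraMap ℝ 𝕜 2 = 2 := map_ofNat _ 2
  linear_combination (-(algebraMap ℝ 𝕜 (deriv θ (1 - ‖x‖ ^ 2)) * algebraMap ℝ 𝕜 (x i) * h x)) * h4

/-- The divergence theorem for the field `θ(1 - ‖x‖²) h`, where `θ` vanishes near the boundary of
the ball and `h` is `C¹` in its interior. -/
theorem setIntegral_divergence_radial_mul {θ : ℝ → ℝ} (hθ : ContDiff ℝ 1 θ) {δ : ℝ} (hδ : 0 < δ)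
    (hθ0 : ∀ s ≤ δ, θ s = 0) {h : Fin d → Eu d → 𝕜}
    (hh : ∀ i, ContDiffOn ℝ 1 (h i) (ball 0 1)) :
    ∫ x in ball (0 : Eu d) 1, (((θ (1 - ‖x‖ ^ 2) : ℝ) : 𝕜) * ∑ i, pd i (h i) x -
        2 * ((deriv θ (1 - ‖x‖ ^ 2) : ℝ) : 𝕜) * ∑ i, ((x i : ℝ) : 𝕜) * h i x) = 0 := by
  set F : Fin d → Eu d → 𝕜 := fun i y => ((θ (1 - ‖y‖ ^ 2) : ℝ) : 𝕜) * h i y with hFdef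
  have hs : ContDiff ℝ 1 (fun y : Eu d => 1 - ‖y‖ ^ 2) := contDiff_const.sub (contDiff_norm_sq ℝ)
  have hev : ∀ i, ∀ x ∉ ball (0 : Eu d) 1, F i =ᶠ[𝓝 x] fun _ => 0 := by
    intro i x hx
    have h1 : 1 ≤ ‖x‖ := by simpa using hx
    have h2 : ∀ᶠ y in 𝓝 x, 1 - ‖y‖ ^ 2 < δ :=
      hs.continuous.continuousAt.eventually_lt continuousAt_const (by nlinarith)
    filter_upwards [h2] with y hy
    simp [hFdef, hθ0 _ hy.le]
  have hFC : ∀ i, ContDiff ℝ 1 (F i) := by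
    intro i
    rw [contDiff_iff_contDiffAt]
    intro x
    by_cases hx : x ∈ ball (0 : Eu d) 1
    · have h1 := (hh i).contDiffAt (isOpen_ball.mem_nhds hx)
      exact (RCLike.ofRealCLM.contDiff.comp (hθ.comp hs)).contDiffAt.mul h1
    · exact contDiffAt_const.congr_of_eventuallyEq (hev i x hx)
  have hFc : ∀ i, HasCompactSupport (F i) := fun i =>
    HasCompactSupport.intro (isCompact_closedBall (0 : Eu d) 1) fun x hx =>
      (hev i x fun h => hx (ball_subset_closedBall h)).self_of_nhds
  have hzero : ∫ x, ∑ i, pd i (F i) x = 0 := by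
    rw [integral_finsetSum _ fun i _ => (integral_pd_eq_zero (hFC i) (hFc i) i).1]
    exact Finset.sum_eq_zero fun i _ => (integral_pd_eq_zero (hFC i) (hFc i) i).2
  rw [← setIntegral_eq_integral_of_forall_compl_eq_zero (s := ball (0 : Eu d) 1)] at hzero
  · rw [← hzero]
    refine setIntegral_congr_fun measurableSet_ball fun x hx => ?_
    have : ∀ i, pd i (F i) x = ((θ (1 - ‖x‖ ^ 2) : ℝ) : 𝕜) * pd i (h i) x -
        2 * ((deriv θ (1 - ‖x‖ ^ 2) : ℝ) : 𝕜) * (((x i : ℝ) : 𝕜) * h i x) := fun i =>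
      pd_radial_mul ((hθ.differentiable one_ne_zero) _)
        (((hh i).contDiffAt (isOpen_ball.mem_nhds hx)).differentiableAt one_ne_zero) i
    simp only [this, Finset.sum_sub_distrib, Finset.mul_sum]
  · intro x hx
    refine Finset.sum_eq_zero fun i _ => ?_
    simp [pd, (hev i x hx).fderiv_eq]

/-- The smooth cutoff `s ↦ φ(m s - 1) s ^ α` of the power `s ^ α`, where `φ` is the smooth
transition from `0` to `1`: it vanishes for `s ≤ 1 / m` and equals `s ^ α` for `s ≥ 2 / m`. -/
noncomputable def cutoffPow (α m s : ℝ) : ℝ := Real.smoothTransition (m * s - 1) * s ^ α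

theorem cutoffPow_eq_zero {α m s : ℝ} (hm : 0 < m) (hs : s ≤ 1 / m) : cutoffPow α m s = 0 := by
  have : m * s ≤ 1 := by rwa [le_div_iff₀' hm] at hs
  simp [cutoffPow, Real.smoothTransition.zero_of_nonpos (by linarith : m * s - 1 ≤ 0)]

theorem contDiff_cutoffPow (α : ℝ) {m : ℝ} (hm : 0 < m) : ContDiff ℝ 1 (cutoffPow α m) := by
  rw [contDiff_iff_contDiffAt]
  intro s
  rcases lt_or_ge 0 s with hs | hs
  · have h1 : ContDiff ℝ 1 fun s : ℝ => Real.smoothTransition (m * s - 1) :=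
      (Real.smoothTransition.contDiff (n := 1)).comp (by fun_prop)
    exact h1.contDiffAt.mul (Real.contDiffAt_rpow_const_of_ne hs.ne')
  · have h2 : ∀ᶠ t in 𝓝 s, t < 1 / m := eventually_lt_nhds (hs.trans_lt (by positivity))
    refine (contDiffAt_const (c := (0 : ℝ))).congr_of_eventuallyEq ?_
    filter_upwards [h2] with t ht using cutoffPow_eq_zero hm ht.le

theorem mul_deriv_cutoffPow (α m : ℝ) {s : ℝ} (hs : 0 < s) :
    s * deriv (cutoffPow α m) s =
      (m * s * deriv Real.smoothTransition (m * s - 1) +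
        α * Real.smoothTransition (m * s - 1)) * s ^ α := by
  have h1 : HasDerivAt (fun t : ℝ => m * t - 1) m s := by
    simpa using ((hasDerivAt_id s).const_mul m).sub_const 1
  have h2 : HasDerivAt Real.smoothTransition (deriv Real.smoothTransition (m * s - 1))
      (m * s - 1) :=
    ((Real.smoothTransition.contDiff (n := 1)).differentiable one_ne_zero _).hasDerivAt
  have h3 := (h2.comp s h1).mul (Real.hasDerivAt_rpow_const (p := α) (Or.inl hs.ne'))
  have h4 : deriv (cutoffPow α m) s = _ := h3.deriv
  rw [h4, Real.rpow_sub_one hs.ne']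
  simp only [Function.comp]
  field_simp

theorem deriv_smoothTransition_of_one_lt {t : ℝ} (ht : 1 < t) :
    deriv Real.smoothTransition t = 0 := by
  have : Real.smoothTransition =ᶠ[𝓝 t] fun _ => 1 := by
    filter_upwards [eventually_gt_nhds ht] with u hu
    exact Real.smoothTransition.one_of_one_le hu.le
  simp [this.deriv_eq]

/-- The factor `t φ'(t - 1)` in the derivative of the cutoff power is bounded for `t ≥ 0`, being
continuous and supported in `[1, 2]`. -/
theorem exists_bound_mul_deriv_smoothTransition :
    ∃ K : ℝ, ∀ t : ℝ, 0 ≤ t → |t * deriv Real.smoothTransition (t - 1)| ≤ K := by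
  have hc : Continuous fun t : ℝ => t * deriv Real.smoothTransition (t - 1) :=
    continuous_id.mul (((Real.smoothTransition.contDiff (n := 1)).continuous_deriv le_rfl).comp
      (by fun_prop))
  obtain ⟨K, hK⟩ := (isCompact_Icc (a := (0 : ℝ)) (b := 2)).exists_bound_of_continuousOn
    hc.continuousOn
  refine ⟨K, fun t ht => ?_⟩
  rcases le_or_gt t 2 with h | h
  · exact hK t ⟨ht, h⟩
  · rw [deriv_smoothTransition_of_one_lt (by linarith)]
    simpa using (norm_nonneg _).trans (hK 0 ⟨le_rfl, zero_le_two⟩)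

/-- The divergence theorem for the field `W_α h`, where the normal component of `h` vanishes at
the boundary: `∑ xᵢ hᵢ = (1 - ‖x‖²) k` with `k` bounded. There is no boundary term although `W_α`
may be unbounded. In the proof, `W_α` is replaced by `θ(1 - ‖x‖²)` with `θ` a cutoff power; the
derivative of `θ` only meets the factor `(1 - ‖x‖²) k`, so that dominated convergence applies. -/
theorem wint_divergence (hd : 1 ≤ d) {α : ℝ} (hα : -1 < α) {h : Fin d → Eu d → 𝕜} {k : Eu d → 𝕜}
    (hh : ∀ i, ContDiffOn ℝ 1 (h i) (ball 0 1))
    (hdiv : BddContOnBall fun x => ∑ i, pd i (h i) x) (hk : BddContOnBall k)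
    (hn : ∀ x ∈ ball (0 : Eu d) 1,
      ∑ i, ((x i : ℝ) : 𝕜) * h i x = ((1 - ‖x‖ ^ 2 : ℝ) : 𝕜) * k x) :
    wint α (fun x => ∑ i, pd i (h i) x) = wint α (fun x => ((2 * α : ℝ) : 𝕜) * k x) := by
  set D : Eu d → 𝕜 := fun x => ∑ i, pd i (h i) x with hD
  obtain ⟨K, hK⟩ := exists_bound_mul_deriv_smoothTransition
  obtain ⟨hDc, A, hA⟩ := id hdiv
  obtain ⟨hkc, B, hB⟩ := id hk
  let m : ℕ → ℝ := fun n => n + 1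
  have hm : ∀ n, 0 < m n := fun n => by positivity
  let Φ : ℕ → Eu d → 𝕜 := fun n x =>
    ((cutoffPow α (m n) (1 - ‖x‖ ^ 2) : ℝ) : 𝕜) * D x -
      2 * (((1 - ‖x‖ ^ 2) * deriv (cutoffPow α (m n)) (1 - ‖x‖ ^ 2) : ℝ) : 𝕜) * k x
  have hΦ0 : ∀ n, ∫ x in ball (0 : Eu d) 1, Φ n x = 0 := by
    intro n
    rw [← setIntegral_divergence_radial_mul (contDiff_cutoffPow α (hm n))
      (one_div_pos.2 (hm n)) (fun s hs => cutoffPow_eq_zero (hm n) hs) hh]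
    refine setIntegral_congr_fun measurableSet_ball fun x hx => ?_
    simp only [Φ, hD]
    rw [hn x hx, RCLike.ofReal_mul]
    ring
  have hs : Continuous fun x : Eu d => 1 - ‖x‖ ^ 2 := by fun_prop
  have hlim : Tendsto (fun n => ∫ x in ball (0 : Eu d) 1, Φ n x) atTop
      (𝓝 (∫ x in ball (0 : Eu d) 1,
        (D x - ((2 * α : ℝ) : 𝕜) * k x) * ((weight α x : ℝ) : 𝕜))) := by
    refine tendsto_integral_of_dominated_convergence
      (fun x => (A + 2 * ((K + |α|) * B)) * weight α x) ?_ ?_ ?_ ?_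
    · intro n
      refine ContinuousOn.aestronglyMeasurable ?_ measurableSet_ball
      have h1 : Continuous fun x : Eu d => ((cutoffPow α (m n) (1 - ‖x‖ ^ 2) : ℝ) : 𝕜) :=
        RCLike.continuous_ofReal.comp ((contDiff_cutoffPow α (hm n)).continuous.comp hs)
      have h2 : Continuous fun x : Eu d =>
          (((1 - ‖x‖ ^ 2) * deriv (cutoffPow α (m n)) (1 - ‖x‖ ^ 2) : ℝ) : 𝕜) :=
        RCLike.continuous_ofReal.comp
          (hs.mul (((contDiff_cutoffPow α (hm n)).continuous_deriv le_rfl).comp hs))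
      exact (h1.continuousOn.mul hDc).sub ((continuous_const.mul h2).continuousOn.mul hkc)
    · exact (integrableOn_weight hd hα).const_mul _
    · intro n
      refine ae_restrict_of_forall_mem measurableSet_ball fun x hx => ?_
      have hpos := one_sub_norm_sq_pos hx
      have hw := weight_pos α hx
      have hφ0 := Real.smoothTransition.nonneg (m n * (1 - ‖x‖ ^ 2) - 1)
      have hφ1 := Real.smoothTransition.le_one (m n * (1 - ‖x‖ ^ 2) - 1)
      have b1 : |cutoffPow α (m n) (1 - ‖x‖ ^ 2)| ≤ weight α x := by
        change |_ * weight α x| ≤ _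
        rw [abs_of_nonneg (mul_nonneg hφ0 hw.le)]
        exact mul_le_of_le_one_left hw.le hφ1
      have b2 : |(1 - ‖x‖ ^ 2) * deriv (cutoffPow α (m n)) (1 - ‖x‖ ^ 2)| ≤
          (K + |α|) * weight α x := by
        rw [mul_deriv_cutoffPow α (m n) hpos, abs_mul]
        change _ * |weight α x| ≤ _
        rw [abs_of_pos hw]
        gcongr
        refine (abs_add_le _ _).trans (add_le_add (hK _ (mul_nonneg (hm n).le hpos.le)) ?_)
        rw [abs_mul, abs_of_nonneg hφ0]
        exact mul_le_of_le_one_right (abs_nonneg α) hφ1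
      have hA' := hA x hx
      have hB' := hB x hx
      have hA0 := (norm_nonneg _).trans hA'
      have hB0 := (norm_nonneg _).trans hB'
      calc ‖Φ n x‖ ≤ |cutoffPow α (m n) (1 - ‖x‖ ^ 2)| * ‖D x‖ +
            2 * |(1 - ‖x‖ ^ 2) * deriv (cutoffPow α (m n)) (1 - ‖x‖ ^ 2)| * ‖k x‖ := by
            refine (norm_sub_le _ _).trans (le_of_eq ?_)
            simp only [norm_mul, RCLike.norm_ofReal, RCLike.norm_ofNat]
        _ ≤ weight α x * A + 2 * ((K + |α|) * weight α x) * B := by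
            gcongr
            exact mul_nonneg zero_le_two ((abs_nonneg _).trans b2)
        _ = _ := by ring
    · refine ae_restrict_of_forall_mem measurableSet_ball fun x hx => ?_
      have hpos := one_sub_norm_sq_pos hx
      refine tendsto_const_nhds.congr' ?_
      have hlarge : ∀ᶠ n : ℕ in atTop, 2 / (1 - ‖x‖ ^ 2) < n :=
        tendsto_natCast_atTop_atTop.eventually_gt_atTop _
      filter_upwards [hlarge] with n hn'
      have h1 : 1 < m n * (1 - ‖x‖ ^ 2) - 1 := by
        rw [div_lt_iff₀ hpos] at hn'
        simp only [m]
        nlinarith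
      simp only [Φ]
      rw [mul_deriv_cutoffPow α (m n) hpos, cutoffPow, deriv_smoothTransition_of_one_lt h1,
        Real.smoothTransition.one_of_one_le h1.le]
      simp only [weight, mul_zero, zero_add, mul_one, one_mul, RCLike.ofReal_mul,
        RCLike.ofReal_ofNat]
      ring
  simp only [hΦ0] at hlim
  have h0 := tendsto_nhds_unique tendsto_const_nhds hlim
  have h1 := wint_sub hd hα hdiv ((BddContOnBall.const ((2 * α : ℝ) : 𝕜)).mul hk)
  rw [← sub_eq_zero, ← h1]
  exact h0.symm

/-! ### Polynomial functions and the differential operators acting on them -/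

section polyFun

@[simp] theorem polyFun_C (c : 𝕜) (x : Eu d) : polyFun (MvPolynomial.C c) x = c := by
  simp [polyFun]

@[simp] theorem polyFun_X (i : Fin d) (x : Eu d) :
    polyFun (MvPolynomial.X i : MvPolynomial (Fin d) 𝕜) x = ((x i : ℝ) : 𝕜) := by
  simp [polyFun]

@[simp] theorem polyFun_add (P Q : MvPolynomial (Fin d) 𝕜) (x : Eu d) :
    polyFun (P + Q) x = polyFun P x + polyFun Q x := by simp [polyFun]

@[simp] theorem polyFun_sub (P Q : MvPolynomial (Fin d) 𝕜) (x : Eu d) :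
    polyFun (P - Q) x = polyFun P x - polyFun Q x := by simp [polyFun]

@[simp] theorem polyFun_neg (P : MvPolynomial (Fin d) 𝕜) (x : Eu d) :
    polyFun (-P) x = -polyFun P x := by simp [polyFun]

@[simp] theorem polyFun_mul (P Q : MvPolynomial (Fin d) 𝕜) (x : Eu d) :
    polyFun (P * Q) x = polyFun P x * polyFun Q x := by simp [polyFun]

@[simp] theorem polyFun_sum {ι : Type*} (s : Finset ι) (P : ι → MvPolynomial (Fin d) 𝕜)
    (x : Eu d) : polyFun (∑ i ∈ s, P i) x = ∑ i ∈ s, polyFun (P i) x := by simp [polyFun]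

theorem hasFDerivAt_coord (i : Fin d) (x : Eu d) :
    HasFDerivAt (fun y : Eu d => ((y i : ℝ) : 𝕜))
      ((RCLike.ofRealCLM (K := 𝕜)).comp (EuclideanSpace.proj i : Eu d →L[ℝ] ℝ)) x :=
  ((RCLike.ofRealCLM (K := 𝕜)).comp (EuclideanSpace.proj i : Eu d →L[ℝ] ℝ)).hasFDerivAt

theorem contDiff_polyFun (P : MvPolynomial (Fin d) 𝕜) {n : WithTop ℕ∞} :
    ContDiff ℝ n (polyFun P) := by
  induction P using MvPolynomial.induction_on with
  | C c =>
    rw [show polyFun (MvPolynomial.C c) = fun _ : Eu d => c from funext fun x => polyFun_C c x]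
    exact contDiff_const
  | add P Q hP hQ =>
    rw [show polyFun (P + Q) = fun x => polyFun P x + polyFun Q x from
      funext fun x => polyFun_add P Q x]
    exact hP.add hQ
  | mul_X P i hP =>
    rw [show polyFun (P * MvPolynomial.X i) = fun x : Eu d => polyFun P x * ((x i : ℝ) : 𝕜) from
      funext fun x => by simp]
    exact hP.mul ((RCLike.ofRealCLM (K := 𝕜)).comp
      (EuclideanSpace.proj i : Eu d →L[ℝ] ℝ)).contDiff

theorem differentiable_polyFun (P : MvPolynomial (Fin d) 𝕜) : Differentiable ℝ (polyFun P) :=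
  (contDiff_polyFun P (n := 1)).differentiable one_ne_zero

theorem pd_mul {f g : Eu d → 𝕜} {x : Eu d} (hf : DifferentiableAt ℝ f x)
    (hg : DifferentiableAt ℝ g x) (k : Fin d) :
    pd k (fun y => f y * g y) x = pd k f x * g x + f x * pd k g x := by
  simp only [pd]
  rw [fderiv_fun_mul hf hg]
  simp only [add_apply, smul_apply, smul_eq_mul]
  ring

theorem pd_coord (k i : Fin d) (x : Eu d) :
    pd k (fun y : Eu d => ((y i : ℝ) : 𝕜)) x = if i = k then 1 else 0 := by
  simp only [pd]
  rw [(hasFDerivAt_coord i x).fderiv]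
  by_cases h : i = k <;> simp [h]

theorem pd_polyFun (k : Fin d) (P : MvPolynomial (Fin d) 𝕜) :
    pd k (polyFun P) = polyFun (MvPolynomial.pderiv k P) := by
  funext x
  induction P using MvPolynomial.induction_on with
  | C c =>
    have : polyFun (MvPolynomial.C c) = fun _ : Eu d => c := funext fun y => polyFun_C c y
    simp [pd, this, polyFun]
  | add P Q hP hQ =>
    have : polyFun (P + Q) = fun y => polyFun P y + polyFun Q y :=
      funext fun y => polyFun_add P Q y
    rw [map_add, polyFun_add, ← hP, ← hQ, this]
    simp only [pd]
    rw [fderiv_fun_add (differentiable_polyFun P x) (differentiable_polyFun Q x)]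
    rfl
  | mul_X P i hP =>
    have : polyFun (P * MvPolynomial.X i) = fun y : Eu d => polyFun P y * ((y i : ℝ) : 𝕜) :=
      funext fun y => by simp
    rw [this, pd_mul (differentiable_polyFun P x) (hasFDerivAt_coord i x).differentiableAt,
      pd_coord, hP, MvPolynomial.pderiv_mul, MvPolynomial.pderiv_X]
    by_cases h : i = k
    · subst h; simp
    · rw [Pi.single_eq_of_ne h]
      simp [h, polyFun]

theorem bddContOnBall_polyFun (P : MvPolynomial (Fin d) 𝕜) : BddContOnBall (polyFun P) :=
  .of_continuous (contDiff_polyFun P (n := 1)).continuous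

end polyFun

section operators

open MvPolynomial

/-- The Euler operator `∑ xᵢ ∂ᵢ`. -/
noncomputable def euler (P : MvPolynomial (Fin d) 𝕜) : MvPolynomial (Fin d) 𝕜 :=
  ∑ i, X i * pderiv i P

/-- The Laplacian. -/
noncomputable def lap (P : MvPolynomial (Fin d) 𝕜) : MvPolynomial (Fin d) 𝕜 :=
  ∑ i, pderiv i (pderiv i P)

/-- The operator `-Δ + E² + (d + 2α) E`, with `E` the Euler operator. It represents the form
`B^α` with respect to `⟨·, ·⟩_α`. -/
noncomputable def ballOp (α : ℝ) (P : MvPolynomial (Fin d) 𝕜) : MvPolynomial (Fin d) 𝕜 :=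
  -lap P + euler (euler P) + C ((d + 2 * α : ℝ) : 𝕜) * euler P

/-- The operator `-Δ + (E - 1) (E - 1 + d + 2α)`, expanded, with `E` the Euler operator. The shift
by `-1` makes it intertwine with `ballOp α` through every partial derivative. -/
noncomputable def sobOp (α : ℝ) (P : MvPolynomial (Fin d) 𝕜) : MvPolynomial (Fin d) 𝕜 :=
  -lap P + euler (euler P) + C ((d + 2 * α - 2 : ℝ) : 𝕜) * euler P -
    C ((d + 2 * α - 1 : ℝ) : 𝕜) * P

theorem pderiv_comm (i j : Fin d) (P : MvPolynomial (Fin d) 𝕜) :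
    pderiv i (pderiv j P) = pderiv j (pderiv i P) := by
  rcases eq_or_ne i j with rfl | h
  · rfl
  · ext m
    simp only [coeff_pderiv, Finsupp.add_apply, Finsupp.single_eq_of_ne h,
      Finsupp.single_eq_of_ne h.symm, add_zero, add_right_comm m]
    ring

theorem pderiv_euler (k : Fin d) (P : MvPolynomial (Fin d) 𝕜) :
    pderiv k (euler P) = euler (pderiv k P) + pderiv k P := by
  simp only [euler, map_sum, pderiv_mul, pderiv_X, Finset.sum_add_distrib, pderiv_comm k]
  rw [add_comm]
  congr 1
  simp [Pi.single_apply]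

theorem euler_add (P Q : MvPolynomial (Fin d) 𝕜) : euler (P + Q) = euler P + euler Q := by
  simp [euler, mul_add, Finset.sum_add_distrib]

theorem pderiv_lap (k : Fin d) (P : MvPolynomial (Fin d) 𝕜) :
    pderiv k (lap P) = lap (pderiv k P) := by
  simp only [lap, map_sum, pderiv_comm k]

/-- `∂_k M = L ∂_k`, a consequence of `∂_k E = (E + 1) ∂_k` for the Euler operator `E`. -/
theorem pderiv_sobOp (α : ℝ) (k : Fin d) (P : MvPolynomial (Fin d) 𝕜) :
    pderiv k (sobOp α P) = ballOp α (pderiv k P) := by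
  simp only [sobOp, ballOp, map_add, map_sub, map_neg, pderiv_mul, pderiv_C, zero_add, pderiv_lap,
    pderiv_euler, euler_add]
  simp only [RCLike.ofReal_one, C_1, map_ofNat]
  ring

theorem coeff_euler (s : Fin d →₀ ℕ) (P : MvPolynomial (Fin d) 𝕜) :
    coeff s (euler P) = (s.degree : 𝕜) * coeff s P := by
  classical
  induction P using MvPolynomial.induction_on' with
  | monomial m c =>
    have : euler (monomial m c) = (m.degree : 𝕜) • monomial m c := by
      simp only [euler, X_mul_pderiv_monomial]
      rw [← Finset.sum_smul, Finsupp.degree_eq_sum, Nat.cast_smul_eq_nsmul]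
    rw [this, coeff_smul, coeff_monomial]
    split_ifs with h
    · simp [h]
    · simp
  | add P Q hP hQ => rw [euler_add, coeff_add, coeff_add, hP, hQ, mul_add]

theorem coeff_sobOp (α : ℝ) (s : Fin d →₀ ℕ) (P : MvPolynomial (Fin d) 𝕜) :
    coeff s (sobOp α P) = -coeff s (lap P) +
      ((((s.degree : ℝ) - 1) * (s.degree - 1 + d + 2 * α) : ℝ) : 𝕜) * coeff s P := by
  simp only [sobOp, coeff_add, coeff_sub, coeff_neg, coeff_C_mul, coeff_euler]
  push_cast
  ring

theorem mem_polySpace_iff {n : ℤ} {P : MvPolynomial (Fin d) 𝕜} :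
    P ∈ polySpace 𝕜 d n ↔ ∀ s, coeff s P ≠ 0 → (s.degree : ℤ) ≤ n := by
  unfold polySpace
  split_ifs with hn
  · rw [mem_restrictTotalDegree, totalDegree, Finset.sup_le_iff]
    refine forall_congr' fun s => ?_
    rw [mem_support_iff]
    refine imp_congr_right fun _ => ?_
    rw [Finsupp.degree_eq_sum, Finsupp.sum_fintype _ _ fun _ => rfl]
    omega
  · rw [Submodule.mem_bot]
    constructor
    · rintro rfl s hs
      simp at hs
    · intro h
      ext s
      by_contra hs
      have := h s hs
      omega

theorem polySpace_mono {m n : ℤ} (h : m ≤ n) : polySpace 𝕜 d m ≤ polySpace 𝕜 d n := by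
  intro P hP
  rw [mem_polySpace_iff] at hP ⊢
  exact fun s hs => (hP s hs).trans h

theorem lap_mem_polySpace {n : ℤ} {P : MvPolynomial (Fin d) 𝕜} (hP : P ∈ polySpace 𝕜 d n) :
    lap P ∈ polySpace 𝕜 d (n - 1) := by
  refine Submodule.sum_mem _ fun i _ => ?_
  rw [mem_polySpace_iff] at hP ⊢
  intro s hs
  rw [coeff_pderiv, coeff_pderiv] at hs
  have := hP _ (left_ne_zero_of_mul (left_ne_zero_of_mul hs))
  simp only [map_add, Finsupp.degree_single] at this
  push_cast at this
  omega

theorem sobOp_mem_polySpace (α : ℝ) {n : ℤ} {P : MvPolynomial (Fin d) 𝕜}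
    (hP : P ∈ polySpace 𝕜 d n) : sobOp α P ∈ polySpace 𝕜 d n := by
  have hl := polySpace_mono (sub_le_self n zero_le_one) (lap_mem_polySpace hP)
  rw [mem_polySpace_iff] at hP hl ⊢
  intro s hs
  by_contra hlt
  rw [coeff_sobOp, not_ne_iff.1 fun h => hlt (hP s h), not_ne_iff.1 fun h => hlt (hl s h)] at hs
  simp at hs

/-- On the top-degree part, `sobOp α` acts as a scalar. -/
theorem sobOp_sub_mem_polySpace (α : ℝ) {n : ℕ} {P : MvPolynomial (Fin d) 𝕜}
    (hP : P ∈ polySpace 𝕜 d n) :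
    sobOp α P - C (((n - 1) * (n - 1 + d + 2 * α) : ℝ) : 𝕜) * P ∈ polySpace 𝕜 d ((n : ℤ) - 1) := by
  have hl := lap_mem_polySpace hP
  rw [mem_polySpace_iff] at hP hl ⊢
  intro s hs
  by_contra hlt
  rw [coeff_sub, coeff_C_mul, coeff_sobOp, not_ne_iff.1 fun h => hlt (hl s h)] at hs
  rcases eq_or_ne (coeff s P) 0 with h0 | h0
  · simp [h0] at hs
  · have h1 := hP s h0
    have h2 : s.degree = n := by omega
    simp [h2] at hs

end operators

/-! ### Functions that are continuously differentiable with bounded derivatives -/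

/-- Functions that are `C¹` on the open unit ball and bounded there together with their first
partial derivatives. -/
structure C1OnBall (v : Eu d → 𝕜) : Prop where
  contDiffOn : ContDiffOn ℝ 1 v (ball 0 1)
  bdd : BddContOnBall v
  bdd_pd : ∀ i, BddContOnBall (pd i v)

theorem pd_conj (i : Fin d) (v : Eu d → 𝕜) (x : Eu d) :
    pd i (fun y => conj (v y)) x = conj (pd i v x) := by
  have h := (RCLike.conjCLE (K := 𝕜)).comp_fderiv (f := v) (x := x)
  have h' : (RCLike.conjCLE (K := 𝕜)) ∘ v = fun y => conj (v y) := by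
    funext y
    simp
  rw [h'] at h
  simp [pd, h]

namespace C1OnBall

theorem star {v : Eu d → 𝕜} (hv : C1OnBall v) : C1OnBall (fun x => conj (v x)) where
  contDiffOn := (RCLike.conjCLE (K := 𝕜)).contDiff.comp_contDiffOn hv.contDiffOn
  bdd := hv.bdd.star
  bdd_pd i := (hv.bdd_pd i).star.congr fun x _ => pd_conj i v x

theorem polyFun (P : MvPolynomial (Fin d) 𝕜) : C1OnBall (SobolevBall.polyFun P) where
  contDiffOn := (contDiff_polyFun P).contDiffOn
  bdd := bddContOnBall_polyFun P
  bdd_pd i := by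
    rw [pd_polyFun]
    exact bddContOnBall_polyFun _

theorem bdd_angular {v : Eu d → 𝕜} (hv : C1OnBall v) (i j : Fin d) :
    BddContOnBall (angular i j v) :=
  ((BddContOnBall.coord i).mul (hv.bdd_pd j)).sub ((BddContOnBall.coord j).mul (hv.bdd_pd i))

end C1OnBall

theorem uniqueDiffOn_closedBall_one : UniqueDiffOn ℝ (closedBall (0 : Eu d) 1) :=
  uniqueDiffOn_convex (convex_closedBall 0 1)
    (by rw [interior_closedBall _ one_ne_zero]; exact ⟨0, mem_ball_self one_pos⟩)

/-- On the open ball the derivative agrees with the derivative within the closed ball, which is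
continuous up to the boundary. -/
theorem fderivWithin_closedBall_eq_fderiv {F : Type*} [NormedAddCommGroup F] [NormedSpace ℝ F]
    (q : Eu d → F) {x : Eu d} (hx : x ∈ ball (0 : Eu d) 1) :
    fderivWithin ℝ q (closedBall 0 1) x = fderiv ℝ q x :=
  fderivWithin_of_mem_nhds (closedBall_mem_nhds_of_mem hx)

theorem bddContOnBall_pd {v : Eu d → 𝕜} (hv : ContDiffOn ℝ 1 v (closedBall 0 1)) (i : Fin d) :
    BddContOnBall (pd i v) := by
  have h : ContinuousOn (fun x => fderivWithin ℝ v (closedBall 0 1) x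
      (EuclideanSpace.single i (1 : ℝ))) (closedBall 0 1) :=
    (hv.continuousOn_fderivWithin uniqueDiffOn_closedBall_one le_rfl).clm_apply continuousOn_const
  refine (BddContOnBall.of_continuousOn_closedBall h).congr fun x hx => ?_
  simp only [pd]
  rw [fderivWithin_closedBall_eq_fderiv v hx]

theorem c1OnBall_pd {q : Eu d → 𝕜} (hq : ContDiffOn ℝ 2 q (closedBall 0 1)) (k : Fin d) :
    C1OnBall (pd k q) := by
  set r : Eu d → 𝕜 := fun x => fderivWithin ℝ q (closedBall 0 1) x
    (EuclideanSpace.single k (1 : ℝ)) with hr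
  have h1 : ContDiffOn ℝ 1 r (closedBall 0 1) :=
    (hq.fderivWithin uniqueDiffOn_closedBall_one (m := 1) (by norm_num)).clm_apply
      contDiffOn_const
  have h2 : ∀ x ∈ ball (0 : Eu d) 1, pd k q x = r x := fun x hx => by
    simp only [hr, pd]
    rw [fderivWithin_closedBall_eq_fderiv q hx]
  refine ⟨(h1.mono ball_subset_closedBall).congr h2,
    bddContOnBall_pd (hq.of_le (by norm_num)) k, fun i => (bddContOnBall_pd h1 i).congr ?_⟩
  intro x hx
  have : pd k q =ᶠ[𝓝 x] r := by
    filter_upwards [isOpen_ball.mem_nhds hx] with y hy using h2 y hy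
  simp only [pd]
  rw [← this.fderiv_eq]

/-! ### The form `B^α` and its differential operator -/

/-- Lagrange's identity. -/
theorem sum_sum_Ioi_lagrange (x a b : Fin d → 𝕜) :
    ∑ i, ∑ j ∈ Finset.Ioi i, (x i * a j - x j * a i) * (x i * b j - x j * b i) =
      (∑ i, x i ^ 2) * (∑ i, a i * b i) - (∑ i, x i * a i) * ∑ i, x i * b i := by
  set f : Fin d → Fin d → 𝕜 := fun i j => (x i * a j - x j * a i) * (x i * b j - x j * b i)
  have hsymm : ∀ i j, f j i = f i j := fun i j => by simp only [f]; ring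
  have h1 := Finset.sum_sum_Ioi_add_eq_sum_sum_off_diag f
  have h2 : ∀ i, ∑ j ∈ ({i}ᶜ : Finset (Fin d)), f j i = ∑ j, f j i := fun i => by
    rw [← Finset.sum_compl_add_sum {i}]
    simp [f]
  have h3 : ∑ i, ∑ j, f j i = 2 * ((∑ i, x i ^ 2) * (∑ i, a i * b i) -
      (∑ i, x i * a i) * ∑ i, x i * b i) := by
    have e1 : ∀ u v : Fin d → 𝕜, ∑ i, ∑ j, u j * v i = (∑ i, u i) * ∑ i, v i := fun u v => by
      rw [Finset.sum_comm, Finset.sum_mul_sum]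
    have e2 : ∀ i j, f j i = x j ^ 2 * (a i * b i) + (a j * b j) * x i ^ 2 -
        (x j * a j) * (x i * b i) - (x j * b j) * (x i * a i) := fun i j => by
      simp only [f]; ring
    simp only [e2, Finset.sum_sub_distrib, Finset.sum_add_distrib]
    rw [e1 (fun i => x i ^ 2) fun i => a i * b i, e1 (fun i => a i * b i) fun i => x i ^ 2,
      e1 (fun i => x i * a i) fun i => x i * b i, e1 (fun i => x i * b i) fun i => x i * a i]
    ring
  rw [Finset.sum_congr rfl fun i _ => h2 i, h3] at h1
  simp only [hsymm, ← two_mul, ← Finset.mul_sum] at h1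
  exact mul_left_cancel₀ two_ne_zero h1

theorem ofReal_one_sub_norm_sq (x : Eu d) :
    ((1 - ‖x‖ ^ 2 : ℝ) : 𝕜) = 1 - ∑ i, ((x i : ℝ) : 𝕜) ^ 2 := by
  rw [EuclideanSpace.real_norm_sq_eq]
  simp

/-- By Lagrange's identity, `B^α(u, v)` is the weighted integral of
`∇u · ∇v - (x · ∇u) (x · ∇v)`. -/
theorem formB_eq_wint (hd : 1 ≤ d) {α : ℝ} (hα : -1 < α) {u v : Eu d → 𝕜} (hu : C1OnBall u)
    (hv : C1OnBall v) :
    formB α u v = wint α (fun x => ∑ i, pd i u x * conj (pd i v x) -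
      (∑ i, ((x i : ℝ) : 𝕜) * pd i u x) * ∑ i, ((x i : ℝ) : 𝕜) * conj (pd i v x)) := by
  have h1 : ipT (α + 1) (grad u) (grad v) =
      wint α (fun x => ((1 - ‖x‖ ^ 2 : ℝ) : 𝕜) * ∑ i, pd i u x * conj (pd i v x)) :=
    wint_add_one
  have hg : BddContOnBall fun x => ∑ i, pd i u x * conj (pd i v x) :=
    .sum _ fun i _ => (hu.bdd_pd i).mul (hv.bdd_pd i).star
  have ha : ∀ i j, BddContOnBall fun x => angular i j u x * conj (angular i j v x) := fun i j =>
    (hu.bdd_angular i j).mul (hv.bdd_angular i j).star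
  have h2 : ∑ i : Fin d, ∑ j ∈ Finset.Ioi i, ip α (angular i j u) (angular i j v) =
      wint α (fun x => ∑ i : Fin d, ∑ j ∈ Finset.Ioi i,
        angular i j u x * conj (angular i j v x)) := by
    rw [wint_sum hd hα _ fun i _ => .sum _ fun j _ => ha i j]
    refine Finset.sum_congr rfl fun i _ => ?_
    rw [wint_sum hd hα _ fun j _ => ha i j]
    rfl
  rw [formB, h1, h2, ← wint_add hd hα]
  · refine wint_congr fun x _ => ?_
    have h3 := sum_sum_Ioi_lagrange (fun i => ((x i : ℝ) : 𝕜)) (fun i => pd i u x)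
      (fun i => conj (pd i v x))
    rw [ofReal_one_sub_norm_sq]
    simp only [angular, map_sub, map_mul, RCLike.conj_ofReal]
    rw [h3]
    ring
  · exact (BddContOnBall.of_continuous
      (RCLike.continuous_ofReal.comp (by fun_prop : Continuous fun x : Eu d => 1 - ‖x‖ ^ 2))).mul hg
  · exact .sum _ fun i _ => .sum _ fun j _ => ha i j

theorem sum_pderiv_tangential (U : MvPolynomial (Fin d) 𝕜) :
    ∑ i, MvPolynomial.pderiv i (MvPolynomial.pderiv i U - MvPolynomial.X i * euler U) =
      lap U - MvPolynomial.C (d : 𝕜) * euler U - euler (euler U) := by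
  simp only [map_sub, MvPolynomial.pderiv_mul, MvPolynomial.pderiv_X_self, one_mul,
    Finset.sum_sub_distrib, Finset.sum_add_distrib, Finset.sum_const, Finset.card_univ,
    Fintype.card_fin, nsmul_eq_mul, map_natCast]
  rw [lap, sub_add_eq_sub_sub, ← euler]

/-- Integration by parts: the divergence theorem for the field
`W_α (∇U - x (x · ∇U)) w`, whose normal component carries the factor `1 - ‖x‖²`. -/
theorem wint_tangential_mul_pd (hd : 1 ≤ d) {α : ℝ} (hα : -1 < α) (U : MvPolynomial (Fin d) 𝕜)
    {w : Eu d → 𝕜} (hw : C1OnBall w) :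
    wint α (fun x => ∑ i, polyFun (MvPolynomial.pderiv i U - MvPolynomial.X i * euler U) x *
      pd i w x) = wint α (fun x => polyFun (ballOp α U) x * w x) := by
  set G : Fin d → MvPolynomial (Fin d) 𝕜 :=
    fun i => MvPolynomial.pderiv i U - MvPolynomial.X i * euler U with hG
  set T := lap U - MvPolynomial.C (d : 𝕜) * euler U - euler (euler U) with hT
  have hpd : ∀ x ∈ ball (0 : Eu d) 1, ∑ i, pd i (fun y => polyFun (G i) y * w y) x =
      polyFun T x * w x + ∑ i, polyFun (G i) x * pd i w x := by
    intro x hx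
    have hwx := (hw.contDiffOn.contDiffAt (isOpen_ball.mem_nhds hx)).differentiableAt one_ne_zero
    simp only [pd_mul (differentiable_polyFun _ x) hwx, Finset.sum_add_distrib]
    rw [← Finset.sum_mul, hT, ← sum_pderiv_tangential, polyFun_sum]
    simp only [pd_polyFun, hG]
  have b1 : BddContOnBall fun x => polyFun T x * w x := (bddContOnBall_polyFun T).mul hw.bdd
  have b2 : BddContOnBall fun x => ∑ i, polyFun (G i) x * pd i w x :=
    .sum _ fun i _ => (bddContOnBall_polyFun _).mul (hw.bdd_pd i)
  have b3 : BddContOnBall fun x => polyFun (euler U) x * w x :=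
    (bddContOnBall_polyFun _).mul hw.bdd
  have key := wint_divergence hd hα (h := fun i y => polyFun (G i) y * w y)
    (k := fun x => polyFun (euler U) x * w x)
    (fun i => (contDiff_polyFun (G i)).contDiffOn.mul hw.contDiffOn)
    ((b1.add b2).congr hpd) b3 (fun x _ => by
      have e : polyFun (euler U) x =
          ∑ i, ((x i : ℝ) : 𝕜) * polyFun (MvPolynomial.pderiv i U) x := by simp [euler]
      have e2 : ∀ i, ((x i : ℝ) : 𝕜) * (polyFun (G i) x * w x) =
          (((x i : ℝ) : 𝕜) * polyFun (MvPolynomial.pderiv i U) x) * w x -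
            ((x i : ℝ) : 𝕜) ^ 2 * (polyFun (euler U) x * w x) := fun i => by
        simp only [hG, polyFun_sub, polyFun_mul, polyFun_X]; ring
      simp only [e2, Finset.sum_sub_distrib, ← Finset.sum_mul]
      rw [← e, ofReal_one_sub_norm_sq]
      ring)
  rw [wint_congr hpd, wint_add hd hα b1 b2] at key
  rw [← eq_sub_iff_add_eq', ← wint_sub hd hα ((BddContOnBall.const _).mul b3) b1] at key
  rw [key]
  refine wint_congr fun x _ => ?_
  simp only [hT, ballOp, polyFun_add, polyFun_sub, polyFun_neg, polyFun_mul, polyFun_C,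
    RCLike.ofReal_add, RCLike.ofReal_natCast]
  ring

/-- `ballOp α` represents `B^α` with respect to `⟨·, ·⟩_α`. -/
theorem formB_polyFun (hd : 1 ≤ d) {α : ℝ} (hα : -1 < α) (U : MvPolynomial (Fin d) 𝕜)
    {v : Eu d → 𝕜} (hv : C1OnBall v) :
    formB α (polyFun U) v = ip α (polyFun (ballOp α U)) v := by
  rw [formB_eq_wint hd hα (.polyFun U) hv]
  refine Eq.trans (wint_congr fun x _ => ?_) (wint_tangential_mul_pd hd hα U hv.star)
  simp only [pd_conj, pd_polyFun, polyFun_sub, polyFun_mul, polyFun_X, sub_mul,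
    Finset.sum_sub_distrib, euler, polyFun_sum]
  congr 1
  rw [Finset.mul_sum]
  exact Finset.sum_congr rfl fun i _ => by ring

theorem ip_conj_symm (α : ℝ) (u v : Eu d → 𝕜) : ip α u v = conj (ip α v u) := by
  refine Eq.trans (wint_congr fun x _ => ?_) (wint_conj (f := fun x => v x * conj (u x)))
  simp [mul_comm]

theorem ipT_conj_symm {ι : Type*} [Fintype ι] (α : ℝ) (F G : Eu d → ι → 𝕜) :
    ipT α F G = conj (ipT α G F) := by
  refine Eq.trans (wint_congr fun x _ => ?_)
    (wint_conj (f := fun x => ∑ i, G x i * conj (F x i)))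
  simp [mul_comm]

theorem formB_conj_symm (α : ℝ) (u v : Eu d → 𝕜) : formB α u v = conj (formB α v u) := by
  simp only [formB, map_add, map_sum]
  rw [ipT_conj_symm]
  congr 1
  exact Finset.sum_congr rfl fun i _ => Finset.sum_congr rfl fun j _ => ip_conj_symm _ _ _

theorem formB1_conj_symm (α : ℝ) (u v : Eu d → 𝕜) : formB1 α u v = conj (formB1 α v u) := by
  simp only [formB1, map_sum]
  exact Finset.sum_congr rfl fun k _ => formB_conj_symm _ _ _

/-- `B^{α,1}(P, q) = ⟨∇MP, ∇q⟩_α` for the operator `M = sobOp α`. -/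
theorem formB1_polyFun (hd : 1 ≤ d) {α : ℝ} (hα : -1 < α) (P : MvPolynomial (Fin d) 𝕜)
    {q : Eu d → 𝕜} (hq : ∀ k, C1OnBall (pd k q)) :
    formB1 α (polyFun P) q = ipT α (grad (polyFun (sobOp α P))) (grad q) := by
  have h : ipT α (grad (polyFun (sobOp α P))) (grad q) =
      ∑ k, ip α (pd k (polyFun (sobOp α P))) (pd k q) :=
    wint_sum hd hα Finset.univ (F := fun k x => pd k (polyFun (sobOp α P)) x * conj (pd k q x))
      fun k _ => ((C1OnBall.polyFun _).bdd_pd k).mul (hq k).bdd.star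
  rw [h, formB1]
  refine Finset.sum_congr rfl fun k _ => ?_
  rw [pd_polyFun, pd_polyFun, formB_polyFun hd hα _ (hq k), pderiv_sobOp]

theorem c1OnBall_pd_polyFun (P : MvPolynomial (Fin d) 𝕜) (k : Fin d) :
    C1OnBall (pd k (polyFun P)) := by
  rw [pd_polyFun]
  exact .polyFun _

/-- `B^{α,1}` in terms of second gradients. -/
theorem formB1_eq_hess (hd : 1 ≤ d) {α : ℝ} (hα : -1 < α) {u v : Eu d → 𝕜}
    (hu : ∀ k, C1OnBall (pd k u)) (hv : ∀ k, C1OnBall (pd k v)) :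
    formB1 α u v = ipT (α + 1) (hess u) (hess v) +
      ∑ i : Fin d, ∑ j ∈ Finset.Ioi i, ipT α (angularGrad i j u) (angularGrad i j v) := by
  simp only [formB1, formB, Finset.sum_add_distrib]
  congr 1
  · have h : ∑ k, ipT (α + 1) (grad (pd k u)) (grad (pd k v)) =
        wint (α + 1) (fun x => ∑ k, ∑ i, pd i (pd k u) x * conj (pd i (pd k v) x)) :=
      (wint_sum hd (by linarith) _ fun k _ => .sum _ fun i _ =>
        ((hu k).bdd_pd i).mul ((hv k).bdd_pd i).star).symm
    rw [h]
    refine wint_congr fun x _ => ?_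
    rw [Fintype.sum_prod_type, Finset.sum_comm]
    rfl
  · rw [Finset.sum_comm]
    refine Finset.sum_congr rfl fun i _ => ?_
    rw [Finset.sum_comm]
    refine Finset.sum_congr rfl fun j _ => ?_
    exact (wint_sum hd hα Finset.univ
      (F := fun k x => angular i j (pd k u) x * conj (angular i j (pd k v) x)) fun k _ =>
        ((hu k).bdd_angular i j).mul ((hv k).bdd_angular i j).star).symm

/-! ### Sobolev orthogonal polynomials as eigenfunctions -/

/-- A Sobolev orthogonal polynomial of degree at least `1` has mean zero. -/
theorem ip_one_eq_zero_of_mem (hd : 1 ≤ d) {α : ℝ} (hα : -1 < α) {n : ℕ} (hn : 1 ≤ n)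
    {P : MvPolynomial (Fin d) 𝕜} (hP : P ∈ sobOrthPoly 𝕜 d α n) :
    ip α (polyFun P) (fun _ => 1) = 0 := by
  have h1 : (1 : MvPolynomial (Fin d) 𝕜) ∈ polySpace 𝕜 d ((n : ℤ) - 1) := by
    classical
    rw [mem_polySpace_iff]
    intro s hs
    rw [MvPolynomial.coeff_one] at hs
    have : s = 0 := by
      by_contra h
      exact hs (if_neg fun h' => h h'.symm)
    subst this
    simpa using hn
  have h2 := hP.2 1 h1
  have h3 : polyFun (1 : MvPolynomial (Fin d) 𝕜) = fun _ : Eu d => (1 : 𝕜) := by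
    funext x
    simp [polyFun]
  have h4 : ipT α (grad (polyFun P)) (grad fun _ : Eu d => (1 : 𝕜)) = 0 := by
    simp [ipT, grad, pd]
  have hc : ip α (fun _ : Eu d => (1 : 𝕜)) (fun _ => 1) ≠ 0 := by
    have := wint_one_ne_zero (𝕜 := 𝕜) hd hα
    simpa [ip, wint] using this
  rw [h3, ipSob, h4, zero_add] at h2
  simpa [hc] using h2

theorem ipSob_eq_of_mem (hd : 1 ≤ d) {α : ℝ} (hα : -1 < α) {n : ℕ} (hn : 1 ≤ n)
    {P : MvPolynomial (Fin d) 𝕜} (hP : P ∈ sobOrthPoly 𝕜 d α n) (v : Eu d → 𝕜) :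
    ipSob α (polyFun P) v = ipT α (grad (polyFun P)) (grad v) := by
  simp [ipSob, ip_one_eq_zero_of_mem hd hα hn hP]

/-- The remainder `R = MP - λP` has degree less than `n`, hence is orthogonal to `P`; by symmetry
of `B^{α,1}` its gradient is also orthogonal to that of `MP`. So `⟨∇R, ∇R⟩_α = 0`. -/
theorem grad_sobOp_ae_eq (hd : 1 ≤ d) {α : ℝ} (hα : -1 < α) {n : ℕ} (hn : 1 ≤ n)
    {P : MvPolynomial (Fin d) 𝕜} (hP : P ∈ sobOrthPoly 𝕜 d α n) :
    ∀ᵐ x ∂volume.restrict (ball (0 : Eu d) 1), ∀ i, pd i (polyFun (sobOp α P)) x =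
      (((n - 1) * (n - 1 + d + 2 * α) : ℝ) : 𝕜) * pd i (polyFun P) x := by
  set c : 𝕜 := (((n - 1) * (n - 1 + d + 2 * α) : ℝ) : 𝕜) with hc
  set R := sobOp α P - MvPolynomial.C c * P with hR
  have hRmem : R ∈ polySpace 𝕜 d ((n : ℤ) - 1) := sobOp_sub_mem_polySpace α hP.1
  have hpd : ∀ i x, pd i (polyFun R) x =
      pd i (polyFun (sobOp α P)) x - c * pd i (polyFun P) x := fun i x => by
    simp [pd_polyFun, hR]
  have orth : ∀ Q ∈ polySpace 𝕜 d ((n : ℤ) - 1),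
      ipT α (grad (polyFun P)) (grad (polyFun Q)) = 0 := fun Q hQ => by
    rw [← ipSob_eq_of_mem hd hα hn hP, hP.2 Q hQ]
  have h1 : ipT α (grad (polyFun (sobOp α P))) (grad (polyFun R)) = 0 := by
    rw [← formB1_polyFun hd hα P (c1OnBall_pd_polyFun R), formB1_conj_symm,
      formB1_polyFun hd hα R (c1OnBall_pd_polyFun P), ← ipT_conj_symm]
    exact orth _ (sobOp_mem_polySpace α hRmem)
  have b : ∀ Q Q' : MvPolynomial (Fin d) 𝕜,
      BddContOnBall fun x => ∑ i, pd i (polyFun Q) x * conj (pd i (polyFun Q') x) := fun Q Q' =>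
    .sum _ fun i _ => ((C1OnBall.polyFun Q).bdd_pd i).mul ((C1OnBall.polyFun Q').bdd_pd i).star
  have h2 : wint α (fun x => ∑ i, pd i (polyFun R) x * conj (pd i (polyFun R) x)) = 0 := by
    have e : wint α (fun x => ∑ i, pd i (polyFun R) x * conj (pd i (polyFun R) x)) =
        wint α (fun x => ∑ i, pd i (polyFun (sobOp α P)) x * conj (pd i (polyFun R) x) -
          c * ∑ i, pd i (polyFun P) x * conj (pd i (polyFun R) x)) := by
      refine wint_congr fun x _ => ?_
      rw [Finset.mul_sum, ← Finset.sum_sub_distrib]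
      refine Finset.sum_congr rfl fun i _ => ?_
      nth_rewrite 1 [hpd]
      ring
    rw [e, wint_sub hd hα (b _ _) ((BddContOnBall.const c).mul (b _ _)), wint_const_mul]
    have h3 : wint α (fun x => ∑ i, pd i (polyFun P) x * conj (pd i (polyFun R) x)) = 0 :=
      orth R hRmem
    have h4 : wint α (fun x => ∑ i, pd i (polyFun (sobOp α P)) x * conj (pd i (polyFun R) x)) =
      0 := h1
    rw [h3, h4]
    simp
  filter_upwards [ae_eq_zero_of_wint_sum_eq_zero hd hα
    (fun i => (C1OnBall.polyFun R).bdd_pd i) h2] with x hx i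
  rw [← sub_eq_zero, ← hpd]
  exact hx i

theorem ipT_grad_sobOp (hd : 1 ≤ d) {α : ℝ} (hα : -1 < α) {n : ℕ} (hn : 1 ≤ n)
    {P : MvPolynomial (Fin d) 𝕜} (hP : P ∈ sobOrthPoly 𝕜 d α n) (q : Eu d → 𝕜) :
    ipT α (grad (polyFun (sobOp α P))) (grad q) =
      (((n - 1) * (n - 1 + d + 2 * α) : ℝ) : 𝕜) * ipT α (grad (polyFun P)) (grad q) := by
  refine Eq.trans (integral_congr_ae ?_)
    (wint_const_mul (f := fun x => ∑ i, grad (polyFun P) x i * conj (grad q x i)) _)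
  filter_upwards [grad_sobOp_ae_eq hd hα hn hP] with x hx
  simp only [grad, hx, mul_assoc, Finset.mul_sum]

theorem eigSob_of_one_le (d : ℕ) (α : ℝ) {n : ℕ} (hn : 1 ≤ n) :
    eigSob d α n = (n - 1) * (n - 1 + d + 2 * α) := by
  rcases hn.eq_or_lt with rfl | h
  · simp [eigSob]
  · rw [eigSob, if_neg (by omega), eig, Nat.cast_sub hn, Nat.cast_one]

theorem formB1_eq_zero_of_mem_zero {α : ℝ} {P : MvPolynomial (Fin d) 𝕜}
    (hP : P ∈ sobOrthPoly 𝕜 d α 0) (q : Eu d → 𝕜) : formB1 α (polyFun P) q = 0 := by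
  have hpd : ∀ k, MvPolynomial.pderiv k P = 0 := by
    intro k
    ext s
    rw [MvPolynomial.coeff_pderiv, MvPolynomial.coeff_zero, mul_eq_zero]
    refine Or.inl (not_ne_iff.1 fun h => ?_)
    have := mem_polySpace_iff.1 hP.1 _ h
    rw [map_add, Finsupp.degree_single] at this
    push_cast at this
    omega
  have h0 : polyFun (0 : MvPolynomial (Fin d) 𝕜) = fun _ : Eu d => (0 : 𝕜) := by
    funext x
    simp [polyFun]
  have h1 : ∀ k, pd k (fun _ : Eu d => (0 : 𝕜)) = fun _ => 0 := fun k => by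
    funext x
    simp [pd]
  simp [formB1, formB, ipT, ip, grad, angular, pd_polyFun, hpd, h0, h1]

end SobolevBall

theorem mainTheorem5 {𝕜 : Type*} [RCLike 𝕜] (d : ℕ) (hd : 1 ≤ d) (α : ℝ) (hα : -1 < α)
    (n : ℕ) (p : MvPolynomial (Fin d) 𝕜) (hp : p ∈ SobolevBall.sobOrthPoly 𝕜 d α n)
    (q : SobolevBall.Eu d → 𝕜)
    (hq : ContDiffOn ℝ 2 q (Metric.closedBall (0 : SobolevBall.Eu d) 1)) :
    SobolevBall.formB1 α (SobolevBall.polyFun p) q =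
        SobolevBall.ipT (α + 1) (SobolevBall.hess (SobolevBall.polyFun p)) (SobolevBall.hess q) +
          ∑ i : Fin d, ∑ j ∈ Finset.Ioi i,
            SobolevBall.ipT α (SobolevBall.angularGrad i j (SobolevBall.polyFun p))
              (SobolevBall.angularGrad i j q) ∧
      SobolevBall.formB1 α (SobolevBall.polyFun p) q =
        ((SobolevBall.eigSob d α n : ℝ) : 𝕜) * SobolevBall.ipSob α (SobolevBall.polyFun p) q := by
  have hC := SobolevBall.c1OnBall_pd hq
  refine ⟨SobolevBall.formB1_eq_hess hd hα (SobolevBall.c1OnBall_pd_polyFun p) hC, ?_⟩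
  rcases Nat.eq_zero_or_pos n with rfl | hn
  · rw [SobolevBall.formB1_eq_zero_of_mem_zero hp]
    simp [SobolevBall.eigSob]
  · rw [SobolevBall.formB1_polyFun hd hα p hC, SobolevBall.ipT_grad_sobOp hd hα hn hp,
      SobolevBall.ipSob_eq_of_mem hd hα hn hp, SobolevBall.eigSob_of_one_le d α hn]
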